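/- For a real-valued random variable $X$ with $\mathbb{E}|X|<\infty$ and characteristic function $f_X(t)=\mathbb{E}\,e^{\sqrt{-1}\,tX}$, let $$\mathcal{V}^2(X)=\frac{1}{\pi^2}\int_{\mathbb{R}^2}\frac{|f_X(s+t)-f_X(s)f_X(t)|^2}{s^2\,t^2}\,ds\,dt$$ be the distance variance of $X$. This integral is finite. Let $X_1,X_2,\ldots$ be i.i.d. copies of $X$. For each $n\ge 2$ let $X_{1:n}\le\cdots\le X_{n:n}$ be the order statistics of $(X_1,\ldots,X_n)$, let $D_{k:n}=X_{k+1:n}-X_{k:n}$, $1\le k\le n-1$, be the sample spacings, and set $$\mathcal{U}_n^2=\binom n2^{-2}\sum_{i,j=1}^{n-1}\big(\min(i,j)\big)^2\big(n-\max(i,j)\big)^2D_{i:n}D_{j:n}.$$ Then $\mathcal{U}_n^2$ is a strongly consistent estimator of $\mathcal{V}^2(X)$: almost surely, $\mathcal{U}_n^2\to\mathcal{V}^2(X)$ as $n\to\infty$. Moreover, for $n\ge 4$ let $$\widehat{\mathcal{U}}_n^2=\binom n4^{-1}\sum_{1\le i_1<i_2<i_3<i_4\le n}h(X_{i_1},X_{i_2},X_{i_3},X_{i_4})$$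 be the U-statistic with kernel $h(x_1,\ldots,x_4)=\tfrac23(x_{3:4}-x_{2:4})^2$, where $x_{1:4}\le\cdots\le x_{4:4}$ are the ordered values of $x_1,\ldots,x_4$. Then, almost surely, $\mathcal{U}_n^2-\widehat{\mathcal{U}}_n^2\to0$ as $n\to\infty$. -/

import Mathlib

namespace DistanceVariance

open MeasureTheory

/-- The integrand `|f(s+t) - f(s) f(t)|² / (|s|² |t|²)` in the distance variance of a probability
law `μ` on `ℝ` with characteristic function `f`. -/
noncomputable def integrand (μ : Measure ℝ) (p : ℝ × ℝ) : ℝ :=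
  ‖charFun μ (p.1 + p.2) - charFun μ p.1 * charFun μ p.2‖ ^ 2 / (|p.1| ^ 2 * |p.2| ^ 2)

/-- The distance variance `𝒱²(X)` of a real random variable `X` on `(Ω, P)`. In dimension one the
normalizing constant `π ^ ((p + 1) / 2) / Γ ((p + 1) / 2)` at `p = 1` is `π`. -/
noncomputable def distVar {Ω : Type*} [MeasurableSpace Ω] (P : Measure Ω) (X : Ω → ℝ) : ℝ :=
  1 / Real.pi ^ 2 * ∫ p : ℝ × ℝ, integrand (P.map X) p

/-- The `k`-th order statistic `x_{k:n}`, for `k = 1, …, n` (and `0` for other `k`). -/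
noncomputable def orderStat {n : ℕ} (x : Fin n → ℝ) (k : ℕ) : ℝ :=
  if h : 1 ≤ k ∧ k ≤ n then x (Tuple.sort x ⟨k - 1, by omega⟩) else 0

/-- The `k`-th spacing `D_{k:n} = x_{k+1:n} - x_{k:n}`, for `k = 1, …, n - 1`. -/
noncomputable def spacing {n : ℕ} (x : Fin n → ℝ) (k : ℕ) : ℝ :=
  orderStat x (k + 1) - orderStat x k

/-- `𝒰_n² = C(n,2)⁻² ∑_{i,j=1}^{n-1} min(i,j)² (n - max(i,j))² D_{i:n} D_{j:n}`. -/
noncomputable def spacingDistVar {n : ℕ} (x : Fin n → ℝ) : ℝ :=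
  ((n.choose 2 : ℝ) ^ 2)⁻¹ * ∑ i ∈ Finset.Ico 1 n, ∑ j ∈ Finset.Ico 1 n,
    ((min i j : ℕ) : ℝ) ^ 2 * ((n : ℝ) - ((max i j : ℕ) : ℝ)) ^ 2 * spacing x i * spacing x j

/-- The symmetric kernel `h(x₁,…,x₄) = (2/3) (x_{3:4} - x_{2:4})²`. -/
noncomputable def kernel (x : Fin 4 → ℝ) : ℝ :=
  2 / 3 * (orderStat x 3 - orderStat x 2) ^ 2

open scoped Classical in
/-- The U-statistic `C(n,4)⁻¹ ∑_{i₁ < i₂ < i₃ < i₄} h(x_{i₁}, …, x_{i₄})`. -/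
noncomputable def uStat {n : ℕ} (x : Fin n → ℝ) : ℝ :=
  (n.choose 4 : ℝ)⁻¹ * ∑ i : Fin 4 → Fin n with StrictMono i, kernel (x ∘ i)

end DistanceVariance

namespace DistanceVariance

open MeasureTheory Set Real ComplexConjugate

lemma lintegral_Ioi_mul_exp_neg_mul {s : ℝ} (hs : 0 < s) :
    ∫⁻ t in Ioi (0 : ℝ), ENNReal.ofReal (t * exp (-(t * s))) = ENNReal.ofReal (1 / s ^ 2) := by
  have hint : ∫ t in Ioi (0 : ℝ), t * exp (-(t * s)) = 1 / s ^ 2 := by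
    have := integral_rpow_mul_exp_neg_mul_Ioi (a := 2) (r := s) two_pos hs
    norm_num at this
    rw [one_div, ← this]
    exact setIntegral_congr_fun measurableSet_Ioi fun t _ => by simp only [mul_comm]
  rw [← hint, ofReal_integral_eq_lintegral_ofReal]
  · refine Integrable.of_integral_ne_zero ?_
    rw [hint]
    positivity
  · refine (ae_restrict_mem measurableSet_Ioi).mono fun t ht => ?_
    have : (0 : ℝ) < t := ht
    simp only [Pi.zero_apply]
    positivity

lemma lintegral_Ioi_one_sub_cos_mul_exp_neg_mul {t : ℝ} (ht : 0 < t) :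
    ∫⁻ s in Ioi (0 : ℝ), ENNReal.ofReal ((1 - cos s) * exp (-(t * s)))
      = ENNReal.ofReal (1 / t - t / (t ^ 2 + 1)) := by
  have h1 : (-(t : ℂ)).re < 0 := by simpa using ht
  have h2 : (-(t : ℂ) + Complex.I).re < 0 := by simpa using ht
  have e : (fun s : ℝ => (1 - cos s) * exp (-(t * s))) = fun s : ℝ =>
      (Complex.exp (-(t : ℂ) * s) - Complex.exp ((-(t : ℂ) + Complex.I) * s)).re := by
    funext s
    rw [add_mul, Complex.exp_add, mul_comm Complex.I, ← Complex.ofReal_neg, ← Complex.ofReal_mul,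
      ← Complex.ofReal_exp, ← mul_one_sub, Complex.re_ofReal_mul, Complex.sub_re,
      Complex.exp_ofReal_mul_I_re, Complex.one_re, neg_mul, mul_comm]
  have i1 := integrableOn_exp_mul_complex_Ioi h1 0
  have i2 := integrableOn_exp_mul_complex_Ioi h2 0
  have i3 := i1.sub i2
  rw [← ofReal_integral_eq_lintegral_ofReal]
  · congr 1
    rw [e]
    have := integral_re i3
    simp only [Pi.sub_apply, RCLike.re_eq_complex_re] at this
    rw [this, integral_sub i1 i2, integral_exp_mul_complex_Ioi h1,
      integral_exp_mul_complex_Ioi h2]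
    have : (t : ℝ) ^ 2 + 1 ≠ 0 := by positivity
    simp [Complex.div_re, Complex.normSq_apply]
    field_simp
  · rw [e]
    exact i3.re
  · refine ae_of_all _ fun s => ?_
    have := cos_le_one s
    simp only [Pi.zero_apply]
    have := exp_pos (-(t * s))
    nlinarith

lemma lintegral_Ioi_one_sub_cos_div_sq :
    ∫⁻ s in Ioi (0 : ℝ), ENNReal.ofReal ((1 - cos s) / s ^ 2) = ENNReal.ofReal (π / 2) := by
  have key : ∀ s ∈ Ioi (0 : ℝ), ENNReal.ofReal ((1 - cos s) / s ^ 2)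
      = ∫⁻ t in Ioi (0 : ℝ), ENNReal.ofReal ((1 - cos s) * (t * exp (-(t * s)))) := by
    intro s hs
    have hc : 0 ≤ 1 - cos s := sub_nonneg.2 (cos_le_one s)
    simp_rw [ENNReal.ofReal_mul hc]
    rw [lintegral_const_mul _ (by fun_prop), lintegral_Ioi_mul_exp_neg_mul hs,
      ← ENNReal.ofReal_mul hc, mul_one_div]
  rw [setLIntegral_congr_fun measurableSet_Ioi key, lintegral_lintegral_swap (by fun_prop)]
  have key2 : ∀ t ∈ Ioi (0 : ℝ),
      ∫⁻ s in Ioi (0 : ℝ), ENNReal.ofReal ((1 - cos s) * (t * exp (-(t * s))))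
      = ENNReal.ofReal ((1 + t ^ 2)⁻¹) := by
    intro t ht
    have h0 : (0 : ℝ) < t := ht
    simp_rw [mul_left_comm _ t, ENNReal.ofReal_mul h0.le]
    rw [lintegral_const_mul _ (by fun_prop), lintegral_Ioi_one_sub_cos_mul_exp_neg_mul h0,
      ← ENNReal.ofReal_mul h0.le]
    congr 1
    have : (t : ℝ) ^ 2 + 1 ≠ 0 := by positivity
    field_simp
    ring
  rw [setLIntegral_congr_fun measurableSet_Ioi key2, ← ofReal_integral_eq_lintegral_ofReal
    integrable_inv_one_add_sq.integrableOn (ae_of_all _ fun t => by positivity),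
    integral_Ioi_inv_one_add_sq]
  simp

lemma integral_one_sub_cos_div_sq : ∫ s : ℝ, (1 - cos s) / s ^ 2 = π := by
  have h := integral_comp_abs (f := fun s : ℝ => (1 - cos s) / s ^ 2)
  simp only [cos_abs, sq_abs] at h
  rw [h, integral_eq_lintegral_of_nonneg_ae
    (ae_of_all _ fun s => div_nonneg (sub_nonneg.2 (cos_le_one s)) (sq_nonneg s))
    (Measurable.aestronglyMeasurable (by fun_prop)), lintegral_Ioi_one_sub_cos_div_sq,
    ENNReal.toReal_ofReal (by positivity)]
  ring

lemma integrable_one_sub_cos_div_sq : Integrable fun s : ℝ => (1 - cos s) / s ^ 2 :=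
  .of_integral_ne_zero (integral_one_sub_cos_div_sq ▸ pi_ne_zero)

lemma integral_one_sub_cos_mul_div_sq (a : ℝ) :
    Integrable (fun s : ℝ => (1 - cos (a * s)) / s ^ 2) ∧
      ∫ s : ℝ, (1 - cos (a * s)) / s ^ 2 = π * |a| := by
  rcases eq_or_ne a 0 with rfl | ha
  · simp
  have e : (fun s : ℝ => (1 - cos (a * s)) / s ^ 2)
      = fun s => a ^ 2 * ((1 - cos (a * s)) / (a * s) ^ 2) := by
    funext s
    field_simp
  rw [e]
  refine ⟨(integrable_one_sub_cos_div_sq.comp_mul_left' ha).const_mul _, ?_⟩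
  rw [integral_const_mul, Measure.integral_comp_mul_left (fun s => (1 - cos s) / s ^ 2),
    integral_one_sub_cos_div_sq, smul_eq_mul, abs_inv, ← sq_abs a]
  have := abs_pos.2 ha
  field_simp

/-- The complex exponentials `x ↦ exp (i s x)`, scaled by `1 / |s|`. -/
noncomputable def expFamily (s x : ℝ) : ℂ := ((|s|⁻¹ : ℝ) : ℂ) * Complex.exp (s * x * Complex.I)

lemma normSq_expFamily_sub (s x y : ℝ) :
    ‖expFamily s x - expFamily s y‖ ^ 2 = 2 * ((1 - cos ((x - y) * s)) / s ^ 2) := by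
  rw [expFamily, expFamily, ← mul_sub, norm_mul, mul_pow, Complex.norm_real,
    norm_inv, norm_abs_eq_norm, norm_eq_abs, inv_pow, sq_abs]
  have : ‖Complex.exp (s * x * Complex.I) - Complex.exp (s * y * Complex.I)‖ ^ 2
      = 2 * (1 - cos ((x - y) * s)) := by
    rw [← Complex.normSq_eq_norm_sq, ← Complex.ofReal_mul, ← Complex.ofReal_mul,
      Complex.normSq_apply]
    simp only [Complex.sub_re, Complex.sub_im, Complex.exp_ofReal_mul_I_re,
      Complex.exp_ofReal_mul_I_im]
    rw [show (x - y) * s = s * x - s * y by ring, cos_sub]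
    nlinarith [sin_sq_add_cos_sq (s * x), sin_sq_add_cos_sq (s * y)]
  rw [this]
  ring

lemma integrable_normSq_expFamily_sub (x y : ℝ) :
    Integrable fun s => ‖expFamily s x - expFamily s y‖ ^ 2 := by
  simp_rw [normSq_expFamily_sub]
  exact (integral_one_sub_cos_mul_div_sq _).1.const_mul _

lemma integral_normSq_expFamily_sub (x y : ℝ) :
    ∫ s, ‖expFamily s x - expFamily s y‖ ^ 2 = 2 * π * |x - y| := by
  simp_rw [normSq_expFamily_sub]
  rw [integral_const_mul, (integral_one_sub_cos_mul_div_sq _).2, mul_assoc]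

lemma im_integral_expFamily (x₁ x₂ x₃ x₄ : ℝ) :
    (∫ s, (expFamily s x₁ - expFamily s x₂) * conj (expFamily s x₃ - expFamily s x₄)).im = 0 := by
  rw [← Complex.conj_eq_iff_im, ← integral_conj, ← integral_neg_eq_self]
  congr 1
  funext s
  have h : ∀ x, expFamily (-s) x = conj (expFamily s x) := fun x => by
    simp [expFamily, ← Complex.exp_conj]
  simp [h]

lemma measurable_expFamily : Measurable (Function.uncurry expFamily) := by
  unfold expFamily Function.uncurry
  fun_prop

lemma norm_expFamily_le (s x : ℝ) : ‖expFamily s x‖ ≤ |s|⁻¹ := by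
  rw [expFamily, norm_mul, ← Complex.ofReal_mul, Complex.norm_exp_ofReal_mul_I]
  simp

end DistanceVariance

namespace DistanceVariance

open MeasureTheory Set Real ComplexConjugate

/-- The cross difference of the distances between two pairs of points. -/
def crossDist (z : (ℝ × ℝ) × (ℝ × ℝ)) : ℝ :=
  |z.1.1 - z.2.2| + |z.1.2 - z.2.1| - |z.1.1 - z.2.1| - |z.1.2 - z.2.2|

/-- The covariance of two functions under `μ`, without conjugation. -/
noncomputable def cov (μ : Measure ℝ) (f g : ℝ → ℂ) : ℂ :=
  ∫ x, f x * g x ∂μ - (∫ x, f x ∂μ) * ∫ x, g x ∂μ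

/-- A measurable family of bounded functions `e u` on `ℝ` which embeds `(ℝ, |x - y|)`, scaled by
`c`, as squared distances into `L²`. -/
structure IsDistFamily (e : ℝ → ℝ → ℂ) (c : ℝ) : Prop where
  measurable : Measurable (Function.uncurry e)
  bounded : ∀ u, ∃ C, ∀ x, ‖e u x‖ ≤ C
  integrable : ∀ x y, Integrable fun u => ‖e u x - e u y‖ ^ 2
  integral_eq : ∀ x y, ∫ u, ‖e u x - e u y‖ ^ 2 = c * |x - y|
  im_eq : ∀ x₁ x₂ x₃ x₄, (∫ u, (e u x₁ - e u x₂) * conj (e u x₃ - e u x₄)).im = 0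

lemma isDistFamily_expFamily : IsDistFamily expFamily (2 * π) where
  measurable := measurable_expFamily
  bounded s := ⟨_, norm_expFamily_le s⟩
  integrable := integrable_normSq_expFamily_sub
  integral_eq := integral_normSq_expFamily_sub
  im_eq := im_integral_expFamily

variable {e : ℝ → ℝ → ℂ} {c : ℝ}

namespace IsDistFamily

lemma measurable_right (h : IsDistFamily e c) (u : ℝ) : Measurable (e u) :=
  h.measurable.comp measurable_prodMk_left

lemma measurable_left (h : IsDistFamily e c) (x : ℝ) : Measurable fun u => e u x :=
  h.measurable.comp measurable_prodMk_right

lemma measurable_comp {α : Type*} [MeasurableSpace α] (h : IsDistFamily e c) {f g : α → ℝ}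
    (hf : Measurable f) (hg : Measurable g) : Measurable fun a => e (f a) (g a) :=
  h.measurable.comp (hf.prodMk hg)

lemma memLp_sub (h : IsDistFamily e c) (x y : ℝ) : MemLp (fun u => e u x - e u y) 2 :=
  (memLp_two_iff_integrable_sq_norm
    ((h.measurable_left x).sub (h.measurable_left y)).aestronglyMeasurable).2 (h.integrable x y)

lemma integrable_mul_conj (h : IsDistFamily e c) (x₁ x₂ x₃ x₄ : ℝ) :
    Integrable fun u => (e u x₁ - e u x₂) * conj (e u x₃ - e u x₄) :=
  (h.memLp_sub x₁ x₂).integrable_mul (h.memLp_sub x₃ x₄).star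

lemma const_nonneg (h : IsDistFamily e c) : 0 ≤ c := by
  have := h.integral_eq 1 0
  norm_num at this
  rw [← this]
  positivity

lemma integral_mul_conj (h : IsDistFamily e c) (x₁ x₂ x₃ x₄ : ℝ) :
    ∫ u, (e u x₁ - e u x₂) * conj (e u x₃ - e u x₄)
      = ((c / 2 * crossDist ((x₁, x₂), (x₃, x₄)) : ℝ) : ℂ) := by
  apply Complex.ext
  · rw [Complex.ofReal_re]
    have h1 := integral_re (h.integrable_mul_conj x₁ x₂ x₃ x₄)
    simp only [RCLike.re_eq_complex_re] at h1
    rw [← h1]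
    have hp : ∀ u, ((e u x₁ - e u x₂) * conj (e u x₃ - e u x₄)).re
        = 1 / 2 * (‖e u x₁ - e u x₄‖ ^ 2 + ‖e u x₂ - e u x₃‖ ^ 2 - ‖e u x₁ - e u x₃‖ ^ 2
          - ‖e u x₂ - e u x₄‖ ^ 2) := fun u => by
      simp only [← Complex.normSq_eq_norm_sq, Complex.normSq_apply, Complex.mul_re,
        Complex.conj_re, Complex.conj_im, Complex.sub_re, Complex.sub_im]
      ring
    simp_rw [hp]
    rw [integral_const_mul, integral_sub, integral_sub, integral_add, h.integral_eq, h.integral_eq,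
      h.integral_eq, h.integral_eq, crossDist]
    · ring
    · exact h.integrable _ _
    · exact h.integrable _ _
    · exact (h.integrable _ _).add (h.integrable _ _)
    · exact h.integrable _ _
    · exact ((h.integrable _ _).add (h.integrable _ _)).sub (h.integrable _ _)
    · exact h.integrable _ _
  · rw [h.im_eq, Complex.ofReal_im]

lemma sq_integral_norm_mul_conj_le (h : IsDistFamily e c) (x₁ x₂ x₃ x₄ : ℝ) :
    (∫ u, ‖(e u x₁ - e u x₂) * conj (e u x₃ - e u x₄)‖) ^ 2
      ≤ c ^ 2 * (|x₁ - x₂| * |x₃ - x₄|) := by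
  have h1 := integral_mul_norm_le_Lp_mul_Lq (μ := volume) Real.HolderConjugate.two_two
    (f := fun u => e u x₁ - e u x₂) (g := fun u => e u x₃ - e u x₄)
    (by simpa using h.memLp_sub x₁ x₂) (by simpa using h.memLp_sub x₃ x₄)
  simp only [rpow_two, h.integral_eq] at h1
  simp only [norm_mul, RCLike.norm_conj]
  have hc := h.const_nonneg
  refine (pow_le_pow_left₀ (by positivity) h1 2).trans (le_of_eq ?_)
  rw [← sqrt_eq_rpow, ← sqrt_eq_rpow, mul_pow, sq_sqrt (by positivity), sq_sqrt (by positivity)]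
  ring

/-- The integrand whose two iterated integrals are compared. -/
def quad (e : ℝ → ℝ → ℂ) (p : ℝ × ℝ) (z : (ℝ × ℝ) × (ℝ × ℝ)) : ℂ :=
  ((e p.1 z.1.1 - e p.1 z.1.2) * conj (e p.1 z.2.1 - e p.1 z.2.2)) *
    ((e p.2 z.1.1 - e p.2 z.1.2) * conj (e p.2 z.2.1 - e p.2 z.2.2))

lemma measurable_quad (h : IsDistFamily e c) : Measurable (Function.uncurry (quad e)) := by
  have m : ∀ f g : (ℝ × ℝ) × (ℝ × ℝ) × (ℝ × ℝ) → ℝ, Measurable f → Measurable g →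
    Measurable fun a => e (f a) (g a) := fun f g => h.measurable_comp
  have cj : Measurable (conj : ℂ → ℂ) := Complex.continuous_conj.measurable
  unfold quad Function.uncurry
  refine .mul (.mul (.sub ?_ ?_) (cj.comp (.sub ?_ ?_)))
    (.mul (.sub ?_ ?_) (cj.comp (.sub ?_ ?_)))
  all_goals exact m _ _ (by fun_prop) (by fun_prop)

lemma integrable_quad (h : IsDistFamily e c) {μ : Measure ℝ} [IsProbabilityMeasure μ]
    (hμ : Integrable id μ) :
    Integrable (Function.uncurry (quad e)) (volume.prod ((μ.prod μ).prod (μ.prod μ))) := by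
  have hm := h.measurable_quad.aestronglyMeasurable
    (μ := volume.prod ((μ.prod μ).prod (μ.prod μ)))
  rw [integrable_prod_iff' hm]
  refine ⟨ae_of_all _ fun z => ?_, ?_⟩
  · have h1 := h.integrable_mul_conj z.1.1 z.1.2 z.2.1 z.2.2
    simpa only [Function.uncurry, quad, Measure.volume_eq_prod] using h1.mul_prod h1
  · have hd : Integrable (fun p : ℝ × ℝ => |p.1 - p.2|) (μ.prod μ) :=
      ((hμ.comp_fst μ).sub (hμ.comp_snd μ)).abs
    refine ((hd.mul_prod hd).const_mul (c ^ 2)).mono'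
      hm.norm.prod_swap.integral_prod_right' ?_
    refine ae_of_all _ fun z => ?_
    rw [norm_of_nonneg (by positivity)]
    refine le_trans (le_of_eq ?_) (h.sq_integral_norm_mul_conj_le _ _ _ _)
    rw [sq, ← integral_prod_mul]
    simp only [Function.uncurry, quad, norm_mul, Measure.volume_eq_prod]

lemma integrable_of_bounded (h : IsDistFamily e c) (μ : Measure ℝ) [IsProbabilityMeasure μ]
    (u : ℝ) : Integrable (e u) μ := by
  obtain ⟨C, hC⟩ := h.bounded u
  exact .of_bound (h.measurable_right u).aestronglyMeasurable C (ae_of_all _ hC)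

lemma integrable_mul (h : IsDistFamily e c) (μ : Measure ℝ) [IsProbabilityMeasure μ]
    (u v : ℝ) : Integrable (fun x => e u x * e v x) μ := by
  obtain ⟨C, hC⟩ := h.bounded u
  exact (h.integrable_of_bounded μ v).bdd_mul (h.measurable_right u).aestronglyMeasurable
    (ae_of_all _ hC)

lemma integral_sub_mul_sub (h : IsDistFamily e c) (μ : Measure ℝ) [IsProbabilityMeasure μ]
    (u v : ℝ) :
    ∫ p : ℝ × ℝ, (e u p.1 - e u p.2) * (e v p.1 - e v p.2) ∂(μ.prod μ)
      = 2 * cov μ (e u) (e v) := by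
  have hu := h.integrable_of_bounded μ u
  have hv := h.integrable_of_bounded μ v
  have huv := h.integrable_mul μ u v
  have e1 : ∀ p : ℝ × ℝ, (e u p.1 - e u p.2) * (e v p.1 - e v p.2)
      = e u p.1 * e v p.1 + e u p.2 * e v p.2 - (e u p.1 * e v p.2 + e v p.1 * e u p.2) :=
    fun p => by ring
  simp_rw [e1]
  rw [integral_sub, integral_add, integral_add, integral_prod_mul, integral_prod_mul,
    integral_fun_fst (fun x => e u x * e v x), integral_fun_snd (fun x => e u x * e v x), cov]
  · simp
    ring
  · exact hu.mul_prod hv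
  · exact hv.mul_prod hu
  · exact huv.comp_fst μ
  · exact huv.comp_snd μ
  · exact (huv.comp_fst μ).add (huv.comp_snd μ)
  · exact (hu.mul_prod hv).add (hv.mul_prod hu)

lemma integral_quad_right (h : IsDistFamily e c) (μ : Measure ℝ) [IsProbabilityMeasure μ]
    (p : ℝ × ℝ) :
    ∫ z, quad e p z ∂((μ.prod μ).prod (μ.prod μ))
      = ((4 * ‖cov μ (e p.1) (e p.2)‖ ^ 2 : ℝ) : ℂ) := by
  have e1 : ∀ z, quad e p z
      = ((e p.1 z.1.1 - e p.1 z.1.2) * (e p.2 z.1.1 - e p.2 z.1.2)) *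
        conj ((e p.1 z.2.1 - e p.1 z.2.2) * (e p.2 z.2.1 - e p.2 z.2.2)) := fun z => by
    rw [quad, map_mul]
    ring
  simp_rw [e1]
  rw [integral_prod_mul (μ := μ.prod μ) (ν := μ.prod μ)
    (fun w : ℝ × ℝ => (e p.1 w.1 - e p.1 w.2) * (e p.2 w.1 - e p.2 w.2))
    (fun w : ℝ × ℝ => conj ((e p.1 w.1 - e p.1 w.2) * (e p.2 w.1 - e p.2 w.2))),
    integral_conj, h.integral_sub_mul_sub, Complex.mul_conj, Complex.normSq_eq_norm_sq, norm_mul]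
  norm_num [mul_pow]

lemma integral_quad_left (h : IsDistFamily e c) (z : (ℝ × ℝ) × (ℝ × ℝ)) :
    ∫ p, quad e p z = ((c ^ 2 / 4 * crossDist z ^ 2 : ℝ) : ℂ) := by
  unfold quad
  rw [Measure.volume_eq_prod, integral_prod_mul
    (fun u => (e u z.1.1 - e u z.1.2) * conj (e u z.2.1 - e u z.2.2))
    (fun u => (e u z.1.1 - e u z.1.2) * conj (e u z.2.1 - e u z.2.2)), h.integral_mul_conj]
  push_cast
  ring

theorem integrable_normSq_cov (h : IsDistFamily e c) {μ : Measure ℝ} [IsProbabilityMeasure μ]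
    (hμ : Integrable id μ) :
    Integrable fun p : ℝ × ℝ => ‖cov μ (e p.1) (e p.2)‖ ^ 2 := by
  have h1 := (h.integrable_quad hμ).integral_prod_left.re
  simp only [Function.uncurry_apply_pair, h.integral_quad_right] at h1
  refine (h1.const_mul (1 / 4)).congr (ae_of_all _ fun p => ?_)
  simp only [RCLike.re_eq_complex_re, Complex.ofReal_re]
  ring

theorem integral_normSq_cov (h : IsDistFamily e c) {μ : Measure ℝ} [IsProbabilityMeasure μ]
    (hμ : Integrable id μ) :
    ∫ p : ℝ × ℝ, ‖cov μ (e p.1) (e p.2)‖ ^ 2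
      = c ^ 2 / 16 * ∫ z, crossDist z ^ 2 ∂((μ.prod μ).prod (μ.prod μ)) := by
  have h1 := integral_integral_swap (h.integrable_quad hμ)
  simp only [h.integral_quad_right, h.integral_quad_left, integral_complex_ofReal, Complex.ofReal_inj,
    integral_const_mul] at h1
  linarith

end IsDistFamily

/-- The indicators of the half-lines `(-∞, u]`. -/
noncomputable def stepFamily (u x : ℝ) : ℝ := (Iic u).indicator 1 x

lemma abs_stepFamily_sub (u x y : ℝ) :
    |stepFamily u x - stepFamily u y| = (Ico (min x y) (max x y)).indicator 1 u := by
  simp only [stepFamily, indicator, mem_Iic, mem_Ico, Pi.one_apply, min_le_iff, lt_max_iff]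
  by_cases h1 : x ≤ u <;> by_cases h2 : y ≤ u <;> simp [h1, h2, not_le.1, not_lt.2]

lemma integrable_abs_stepFamily_sub (x y : ℝ) :
    Integrable fun u => |stepFamily u x - stepFamily u y| := by
  simp_rw [abs_stepFamily_sub]
  exact (integrable_indicator_iff measurableSet_Ico).2 (integrableOn_const (by simp) (by simp))

lemma integral_abs_stepFamily_sub (x y : ℝ) :
    ∫ u, |stepFamily u x - stepFamily u y| = |x - y| := by
  simp_rw [abs_stepFamily_sub]
  rw [integral_indicator_one measurableSet_Ico, Measure.real, Real.volume_Ico, max_sub_min_eq_abs,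
    ENNReal.toReal_ofReal (abs_nonneg _), abs_sub_comm]

lemma sq_abs_stepFamily_sub (u x y : ℝ) :
    |stepFamily u x - stepFamily u y| ^ 2 = |stepFamily u x - stepFamily u y| := by
  rw [abs_stepFamily_sub, indicator]
  split_ifs <;> simp

lemma measurable_stepFamily : Measurable (Function.uncurry stepFamily) := by
  have : Function.uncurry stepFamily = {p : ℝ × ℝ | p.2 ≤ p.1}.indicator 1 := by
    ext p
    simp [stepFamily, indicator, Function.uncurry]
  rw [this]
  exact measurable_one.indicator (measurableSet_le measurable_snd measurable_fst)

lemma stepFamily_nonneg (u x : ℝ) : 0 ≤ stepFamily u x := by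
  unfold stepFamily indicator
  split_ifs <;> simp

lemma stepFamily_le_one (u x : ℝ) : stepFamily u x ≤ 1 := by
  unfold stepFamily indicator
  split_ifs <;> simp

lemma isDistFamily_stepFamily : IsDistFamily (fun u x => (stepFamily u x : ℂ)) 1 where
  measurable := Complex.measurable_ofReal.comp measurable_stepFamily
  bounded u := ⟨1, fun x => by
    rw [Complex.norm_real, norm_of_nonneg (stepFamily_nonneg u x)]
    exact stepFamily_le_one u x⟩
  integrable x y := by
    simp_rw [← Complex.ofReal_sub, Complex.norm_real, norm_eq_abs, sq_abs_stepFamily_sub]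
    exact integrable_abs_stepFamily_sub x y
  integral_eq x y := by
    simp_rw [← Complex.ofReal_sub, Complex.norm_real, norm_eq_abs, sq_abs_stepFamily_sub]
    rw [integral_abs_stepFamily_sub, one_mul]
  im_eq x₁ x₂ x₃ x₄ := by
    simp_rw [← Complex.ofReal_sub, Complex.conj_ofReal, ← Complex.ofReal_mul]
    rw [integral_complex_ofReal]
    exact Complex.ofReal_im _

/-- The distribution function of `μ`, as a mean of indicators. -/
noncomputable def distFun (μ : Measure ℝ) (u : ℝ) : ℝ := ∫ x, stepFamily u x ∂μ

lemma stepFamily_mul (u v x : ℝ) : stepFamily u x * stepFamily v x = stepFamily (min u v) x := by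
  simp only [stepFamily, ← Iic_inter_Iic, inter_indicator_one, Pi.mul_apply]

lemma cov_stepFamily (μ : Measure ℝ) (u v : ℝ) :
    cov μ (fun x => (stepFamily u x : ℂ)) (fun x => (stepFamily v x : ℂ))
      = ((distFun μ (min u v) * (1 - distFun μ (max u v)) : ℝ) : ℂ) := by
  simp_rw [cov, ← Complex.ofReal_mul, stepFamily_mul, integral_complex_ofReal]
  rw [← Complex.ofReal_mul, ← Complex.ofReal_sub, mul_sub, mul_one]
  congr 2
  exact (fn_min_mul_fn_max (distFun μ) u v).symm

lemma normSq_cov_expFamily (μ : Measure ℝ) (p : ℝ × ℝ) :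
    ‖cov μ (expFamily p.1) (expFamily p.2)‖ ^ 2 = integrand μ p := by
  have h1 : ∀ s, ∫ x, expFamily s x ∂μ = ((|s|⁻¹ : ℝ) : ℂ) * charFun μ s := fun s => by
    rw [charFun_apply_real, ← integral_const_mul]
    rfl
  have h2 : ∀ s t, ∫ x, expFamily s x * expFamily t x ∂μ
      = ((|s|⁻¹ : ℝ) : ℂ) * ((|t|⁻¹ : ℝ) : ℂ) * charFun μ (s + t) := fun s t => by
    rw [charFun_apply_real, ← integral_const_mul]
    congr 1
    funext x
    rw [expFamily, expFamily, Complex.ofReal_add, add_mul, add_mul, Complex.exp_add]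
    ring
  rw [cov, h1, h1, h2, integrand]
  rw [show ((|p.1|⁻¹ : ℝ) : ℂ) * ((|p.2|⁻¹ : ℝ) : ℂ) * charFun μ (p.1 + p.2)
      - ((|p.1|⁻¹ : ℝ) : ℂ) * charFun μ p.1 * (((|p.2|⁻¹ : ℝ) : ℂ) * charFun μ p.2)
      = ((|p.1|⁻¹ : ℝ) : ℂ) * ((|p.2|⁻¹ : ℝ) : ℂ)
        * (charFun μ (p.1 + p.2) - charFun μ p.1 * charFun μ p.2) by ring]
  simp only [norm_mul, Complex.norm_real, norm_inv, norm_abs_eq_norm, norm_eq_abs]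
  field_simp

theorem integrable_integrand {μ : Measure ℝ} [IsProbabilityMeasure μ] (hμ : Integrable id μ) :
    Integrable (integrand μ) := by
  simpa only [normSq_cov_expFamily] using isDistFamily_expFamily.integrable_normSq_cov hμ

theorem integral_integrand {μ : Measure ℝ} [IsProbabilityMeasure μ] (hμ : Integrable id μ) :
    1 / π ^ 2 * ∫ p, integrand μ p
      = 4 * ∫ p : ℝ × ℝ, (distFun μ (min p.1 p.2) * (1 - distFun μ (max p.1 p.2))) ^ 2 := by
  have h1 := isDistFamily_expFamily.integral_normSq_cov hμ
  have h2 := isDistFamily_stepFamily.integral_normSq_cov hμ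
  simp only [normSq_cov_expFamily] at h1
  simp only [cov_stepFamily, Complex.norm_real, norm_eq_abs, sq_abs] at h2
  rw [h1, h2]
  field_simp
  ring

end DistanceVariance

namespace DistanceVariance

open MeasureTheory Set Real

/-- The number of sample points which are at most `u`. -/
noncomputable def countLE {n : ℕ} (x : Fin n → ℝ) (u : ℝ) : ℕ :=
  (Finset.univ.filter fun i => x i ≤ u).card

variable {n : ℕ}

lemma countLE_mono (x : Fin n → ℝ) : Monotone (countLE x) := fun u v huv =>
  Finset.card_le_card fun i hi => by
    simp only [Finset.mem_filter, Finset.mem_univ, true_and] at hi ⊢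
    exact hi.trans huv

lemma countLE_le (x : Fin n → ℝ) (u : ℝ) : countLE x u ≤ n :=
  (Finset.card_le_univ _).trans_eq (Fintype.card_fin n)

lemma countLE_comp_perm (x : Fin n → ℝ) (σ : Equiv.Perm (Fin n)) (u : ℝ) :
    countLE (x ∘ σ) u = countLE x u :=
  Finset.card_equiv σ (by simp)

lemma lt_countLE_iff (x : Fin n → ℝ) (u : ℝ) (j : Fin n) :
    j < countLE x u ↔ x (Tuple.sort x j) ≤ u := by
  rw [← countLE_comp_perm x (Tuple.sort x) u]
  exact Tuple.lt_card_le_iff_apply_le_of_monotone (Tuple.monotone_sort x)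

lemma le_countLE_iff (x : Fin n → ℝ) (u : ℝ) {k : ℕ} (h1 : 1 ≤ k) (hn : k ≤ n) :
    k ≤ countLE x u ↔ orderStat x k ≤ u := by
  rw [orderStat, dif_pos ⟨h1, hn⟩, ← lt_countLE_iff]
  simp only
  omega

lemma setOf_countLE_eq (x : Fin n → ℝ) {k : ℕ} (h1 : 1 ≤ k) (hn : k < n) :
    {u | countLE x u = k} = Ico (orderStat x k) (orderStat x (k + 1)) := by
  ext u
  rw [mem_ofPred_eq, mem_Ico, ← le_countLE_iff x u h1 hn.le, ← not_le,
    ← le_countLE_iff x u (by omega) hn]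
  omega

lemma spacing_nonneg (x : Fin n → ℝ) {k : ℕ} (h1 : 1 ≤ k) (hn : k < n) : 0 ≤ spacing x k := by
  rw [spacing, sub_nonneg, ← le_countLE_iff x _ h1 hn.le]
  exact (Nat.le_succ k).trans ((le_countLE_iff x _ (by omega) hn).2 le_rfl)

lemma integrable_indicator_countLE (x : Fin n → ℝ) {k : ℕ} (h1 : 1 ≤ k) (hn : k < n) :
    Integrable ({u | countLE x u = k}.indicator (1 : ℝ → ℝ)) := by
  rw [setOf_countLE_eq x h1 hn]
  exact (integrable_indicator_iff measurableSet_Ico).2 (integrableOn_const (by simp) (by simp))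

lemma integral_indicator_countLE (x : Fin n → ℝ) {k : ℕ} (h1 : 1 ≤ k) (hn : k < n) :
    ∫ u, {u | countLE x u = k}.indicator (1 : ℝ → ℝ) u = spacing x k := by
  rw [setOf_countLE_eq x h1 hn, integral_indicator_one measurableSet_Ico, Measure.real,
    Real.volume_Ico, ← spacing, ENNReal.toReal_ofReal (spacing_nonneg x h1 hn)]

lemma integrable_indicator_countLE_mul (x : Fin n → ℝ) {j k : ℕ} (hj : 1 ≤ j) (hjn : j < n)
    (hk : 1 ≤ k) (hkn : k < n) :
    Integrable fun p : ℝ × ℝ => {u | countLE x u = j}.indicator (1 : ℝ → ℝ) p.1 *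
      {u | countLE x u = k}.indicator (1 : ℝ → ℝ) p.2 :=
  (integrable_indicator_countLE x hj hjn).mul_prod (integrable_indicator_countLE x hk hkn)

lemma integral_indicator_countLE_mul (x : Fin n → ℝ) {j k : ℕ} (hj : 1 ≤ j) (hjn : j < n)
    (hk : 1 ≤ k) (hkn : k < n) :
    ∫ p : ℝ × ℝ, {u | countLE x u = j}.indicator (1 : ℝ → ℝ) p.1 *
      {u | countLE x u = k}.indicator (1 : ℝ → ℝ) p.2 = spacing x j * spacing x k := by
  rw [Measure.volume_eq_prod, integral_prod_mul, integral_indicator_countLE x hj hjn,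
    integral_indicator_countLE x hk hkn]

/-- Weighted double sums of spacings as double integrals. -/
lemma sum_mul_spacing_mul_spacing (x : Fin n → ℝ) (w : ℕ → ℕ → ℝ)
    (hw : ∀ i j, i ≤ n → j ≤ n → (i = 0 ∨ j = 0 ∨ i = n ∨ j = n) → w i j = 0) :
    ∑ i ∈ Finset.Ico 1 n, ∑ j ∈ Finset.Ico 1 n, w i j * spacing x i * spacing x j
      = ∫ p : ℝ × ℝ, w (countLE x p.1) (countLE x p.2) := by
  have e : ∀ p : ℝ × ℝ, w (countLE x p.1) (countLE x p.2)
      = ∑ i ∈ Finset.Ico 1 n, ∑ j ∈ Finset.Ico 1 n, w i j *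
        ({u | countLE x u = i}.indicator (1 : ℝ → ℝ) p.1 *
          {u | countLE x u = j}.indicator (1 : ℝ → ℝ) p.2) := fun p => by
    simp only [indicator_apply, mem_ofPred_eq, Pi.one_apply, mul_ite, mul_one, mul_zero,
      Finset.sum_ite_eq, Finset.mem_Ico, Finset.sum_ite_irrel, Finset.sum_const_zero]
    have h1 := countLE_le x p.1
    have h2 := countLE_le x p.2
    have h3 := hw _ _ h1 h2
    grind
  simp_rw [e]
  rw [integral_finsetSum]
  · refine Finset.sum_congr rfl fun i hi => ?_
    rw [Finset.mem_Ico] at hi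
    rw [integral_finsetSum]
    · refine Finset.sum_congr rfl fun j hj => ?_
      rw [Finset.mem_Ico] at hj
      rw [integral_const_mul, integral_indicator_countLE_mul x hi.1 hi.2 hj.1 hj.2, mul_assoc]
    · intro j hj
      rw [Finset.mem_Ico] at hj
      exact (integrable_indicator_countLE_mul x hi.1 hi.2 hj.1 hj.2).const_mul _
  · intro i hi
    rw [Finset.mem_Ico] at hi
    refine integrable_finsetSum _ fun j hj => ?_
    rw [Finset.mem_Ico] at hj
    exact (integrable_indicator_countLE_mul x hi.1 hi.2 hj.1 hj.2).const_mul _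

theorem spacingDistVar_eq_integral (x : Fin n → ℝ) :
    spacingDistVar x = ((n.choose 2 : ℝ) ^ 2)⁻¹ * ∫ p : ℝ × ℝ,
      (countLE x (min p.1 p.2) : ℝ) ^ 2 * ((n : ℝ) - countLE x (max p.1 p.2)) ^ 2 := by
  rw [spacingDistVar, sum_mul_spacing_mul_spacing x
    (fun i j => ((min i j : ℕ) : ℝ) ^ 2 * ((n : ℝ) - ((max i j : ℕ) : ℝ)) ^ 2)]
  · simp_rw [(countLE_mono x).map_min, (countLE_mono x).map_max]
  · rintro i j hi hj (rfl | rfl | rfl | rfl) <;> simp [hi, hj]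

section Counting

variable {α : Type*} [Fintype α] [DecidableEq α]

lemma card_filter_inter_eq_two {A B : Finset α} (hAB : A ⊆ B) :
    ((Finset.powersetCard 4 Finset.univ).filter
      fun T : Finset α => (T ∩ A).card = 2 ∧ (T ∩ B).card = 2).card
      = A.card.choose 2 * (Fintype.card α - B.card).choose 2 := by
  rw [← Finset.card_compl, ← Finset.card_powersetCard, ← Finset.card_powersetCard,
    ← Finset.card_product]
  refine Finset.card_nbij' (fun T => (T ∩ A, T ∩ Bᶜ)) (fun S => S.1 ∪ S.2) ?_ ?_ ?_ ?_
  · intro T hT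
    simp only [Finset.coe_filter, Finset.mem_powersetCard, mem_ofPred_eq] at hT
    simp only [Finset.coe_product, mem_prod, Finset.mem_coe, Finset.mem_powersetCard]
    have := Finset.card_inter_add_card_sdiff T B
    rw [Finset.sdiff_eq_inter_compl] at this
    exact ⟨⟨Finset.inter_subset_right, hT.2.1⟩, Finset.inter_subset_right, by omega⟩
  · rintro ⟨S, T⟩ hS
    simp only [Finset.coe_product, mem_prod, Finset.mem_coe, Finset.mem_powersetCard] at hS
    simp only [Finset.coe_filter, Finset.mem_powersetCard, mem_ofPred_eq]
    obtain ⟨⟨h1, h2⟩, h3, h4⟩ := hS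
    have hd : Disjoint S T :=
      Finset.disjoint_of_subset_left (h1.trans hAB)
        (Finset.disjoint_of_subset_right h3 disjoint_compl_right)
    have hA : (S ∪ T) ∩ A = S := by grind [Finset.mem_compl]
    have hB : (S ∪ T) ∩ B = S := by grind [Finset.mem_compl]
    exact ⟨⟨Finset.subset_univ _, by rw [Finset.card_union_of_disjoint hd, h2, h4]⟩,
      by rw [hA, h2], by rw [hB, h2]⟩
  · intro T hT
    simp only [Finset.coe_filter, Finset.mem_powersetCard, mem_ofPred_eq] at hT
    have : T ∩ A = T ∩ B := Finset.eq_of_subset_of_card_le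
      (Finset.inter_subset_inter_left hAB) (by omega)
    simp only [this, ← Finset.sdiff_eq_inter_compl]
    rw [Finset.union_comm, Finset.sdiff_union_inter]
  · rintro ⟨S, T⟩ hS
    simp only [Finset.coe_product, mem_prod, Finset.mem_coe, Finset.mem_powersetCard] at hS
    obtain ⟨⟨h1, h2⟩, h3, h4⟩ := hS
    ext i <;> grind [Finset.mem_compl]

end Counting

open scoped Classical in
lemma card_filter_strictMono {k : ℕ} (p : Finset (Fin n) → Prop) :
    (Finset.univ.filter fun i : Fin k → Fin n => StrictMono i ∧ p (Finset.univ.image i)).card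
      = ((Finset.powersetCard k Finset.univ).filter p).card := by
  refine Finset.card_bij (fun i _ => Finset.univ.image i) ?_ ?_ ?_
  · intro i hi
    simp only [Finset.mem_filter, Finset.mem_univ, true_and] at hi
    simp only [Finset.mem_filter, Finset.mem_powersetCard, Finset.subset_univ, true_and]
    exact ⟨by simp [Finset.card_image_of_injective _ hi.1.injective], hi.2⟩
  · intro i hi j hj hij
    simp only [Finset.mem_filter, Finset.mem_univ, true_and] at hi hj
    refine (hi.1.range_inj hj.1).1 ?_
    simpa using congrArg (fun s : Finset (Fin n) => (s : Set (Fin n))) hij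
  · intro T hT
    simp only [Finset.mem_filter, Finset.mem_powersetCard, Finset.subset_univ, true_and] at hT
    have : Finset.univ.image (T.orderEmbOfFin hT.1) = T := by simp
    refine ⟨T.orderEmbOfFin hT.1, ?_, this⟩
    simp only [Finset.mem_filter, Finset.mem_univ, true_and, this]
    exact ⟨(T.orderEmbOfFin hT.1).strictMono, hT.2⟩

lemma countLE_comp {k : ℕ} (x : Fin n → ℝ) {i : Fin k → Fin n} (hi : StrictMono i) (u : ℝ) :
    countLE (x ∘ i) u = (Finset.univ.image i ∩ Finset.univ.filter fun j => x j ≤ u).card := by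
  rw [countLE, ← Finset.card_image_of_injective _ hi.injective]
  congr 1
  ext j
  simp
  grind

open scoped Classical in
lemma sum_strictMono_indicator (x : Fin n → ℝ) (p : ℝ × ℝ) :
    ∑ i : Fin 4 → Fin n with StrictMono i, {u | countLE (x ∘ i) u = 2}.indicator (1 : ℝ → ℝ) p.1 *
        {u | countLE (x ∘ i) u = 2}.indicator (1 : ℝ → ℝ) p.2
      = ((countLE x (min p.1 p.2)).choose 2 : ℝ) * ((n - countLE x (max p.1 p.2)).choose 2 : ℝ) := by
  have e : ∀ i : Fin 4 → Fin n, {u | countLE (x ∘ i) u = 2}.indicator (1 : ℝ → ℝ) p.1 *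
        {u | countLE (x ∘ i) u = 2}.indicator (1 : ℝ → ℝ) p.2
      = if countLE (x ∘ i) (min p.1 p.2) = 2 ∧ countLE (x ∘ i) (max p.1 p.2) = 2 then 1 else 0 :=
    fun i => by
      simp only [indicator_apply, mem_ofPred_eq, Pi.one_apply]
      rcases le_total p.1 p.2 with h | h <;> simp only [min_eq_left h, max_eq_right h,
        min_eq_right h, max_eq_left h] <;> grind
  simp_rw [e]
  rw [Finset.sum_boole, Finset.filter_filter, ← Nat.cast_mul, Nat.cast_inj]
  have hAB : (Finset.univ.filter fun j => x j ≤ min p.1 p.2)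
      ⊆ Finset.univ.filter fun j => x j ≤ max p.1 p.2 := fun j hj => by
    simp only [Finset.mem_filter, Finset.mem_univ, true_and] at hj ⊢
    exact hj.trans min_le_max
  have h2 := card_filter_inter_eq_two hAB
  rw [Fintype.card_fin] at h2
  have h3 := card_filter_strictMono (n := n) (k := 4) fun T =>
    (T ∩ Finset.univ.filter fun j => x j ≤ min p.1 p.2).card = 2 ∧
      (T ∩ Finset.univ.filter fun j => x j ≤ max p.1 p.2).card = 2
  rw [countLE, countLE, ← h2]
  refine Eq.trans ?_ (h3.trans ?_)
  · congr 1
    ext i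
    simp only [Finset.mem_filter, Finset.mem_univ, true_and]
    refine and_congr_right fun hi => ?_
    rw [countLE_comp x hi, countLE_comp x hi]
  · congr

theorem uStat_eq_integral (x : Fin n → ℝ) :
    uStat x = (n.choose 4 : ℝ)⁻¹ * (2 / 3 * ∫ p : ℝ × ℝ,
      ((countLE x (min p.1 p.2)).choose 2 : ℝ) * ((n - countLE x (max p.1 p.2)).choose 2 : ℝ)) := by
  classical
  simp_rw [← sum_strictMono_indicator x]
  rw [integral_finsetSum, Finset.mul_sum, uStat]
  · congr 1
    refine Finset.sum_congr rfl fun i _ => ?_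
    rw [integral_indicator_countLE_mul _ one_le_two (by norm_num) one_le_two (by norm_num), kernel,
      spacing, sq]
  · exact fun i _ => integrable_indicator_countLE_mul _ one_le_two (by norm_num) one_le_two
      (by norm_num)

end DistanceVariance

namespace DistanceVariance

open MeasureTheory Set Real Filter Topology

/-- Dominated convergence with converging dominating functions. -/
theorem tendsto_integral_of_tendsto_dominating {α : Type*} [MeasurableSpace α] {μ : Measure α}
    {f g : ℕ → α → ℝ} {F G : α → ℝ} (hfm : ∀ n, AEStronglyMeasurable (f n) μ)
    (hg : ∀ n, Integrable (g n) μ) (hG : Integrable G μ) (hf0 : ∀ n a, 0 ≤ f n a)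
    (hfg : ∀ n a, f n a ≤ g n a) (hfF : ∀ᵐ a ∂μ, Tendsto (fun n => f n a) atTop (𝓝 (F a)))
    (hgG : ∀ᵐ a ∂μ, Tendsto (fun n => g n a) atTop (𝓝 (G a)))
    (hI : Tendsto (fun n => ∫ a, g n a ∂μ) atTop (𝓝 (∫ a, G a ∂μ))) :
    Tendsto (fun n => ∫ a, f n a ∂μ) atTop (𝓝 (∫ a, F a ∂μ)) := by
  have hg0 : ∀ n a, 0 ≤ g n a := fun n a => (hf0 n a).trans (hfg n a)
  have hmin : ∀ {x y : ℝ}, 0 ≤ x → ‖min x y‖ ≤ ‖y‖ := fun {x y} hx => by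
    rw [norm_eq_abs, norm_eq_abs]
    grind
  have hf : ∀ n, Integrable (f n) μ := fun n => (hg n).mono' (hfm n)
    (ae_of_all _ fun a => by rw [norm_of_nonneg (hf0 n a)]; exact hfg n a)
  have h1 : Tendsto (fun n => ∫ a, min (g n a) (G a) ∂μ) atTop (𝓝 (∫ a, G a ∂μ)) := by
    refine tendsto_integral_of_dominated_convergence (fun a => ‖G a‖)
      (fun n => ((hg n).inf hG).aestronglyMeasurable) hG.norm
      (fun n => ae_of_all _ fun a => hmin (hg0 n a)) (hgG.mono fun a ha => ?_)
    simpa using ha.min (tendsto_const_nhds (x := G a))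
  have h2 : Tendsto (fun n => ∫ a, min (f n a) (G a) ∂μ) atTop (𝓝 (∫ a, F a ∂μ)) := by
    refine tendsto_integral_of_dominated_convergence (fun a => ‖G a‖)
      (fun n => ((hf n).inf hG).aestronglyMeasurable) hG.norm
      (fun n => ae_of_all _ fun a => hmin (hf0 n a)) ?_
    filter_upwards [hfF, hgG] with a ha hb
    have := ha.min (tendsto_const_nhds (x := G a))
    rwa [min_eq_left (le_of_tendsto_of_tendsto' ha hb fun n => hfg n a)] at this
  have h3 : Tendsto (fun n => ∫ a, f n a ∂μ - ∫ a, min (f n a) (G a) ∂μ) atTop (𝓝 0) := by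
    refine squeeze_zero (g := fun n => ∫ a, g n a ∂μ - ∫ a, min (g n a) (G a) ∂μ)
      (fun n => ?_) (fun n => ?_) (by simpa using hI.sub h1)
    · rw [sub_nonneg]
      exact integral_mono ((hf n).inf hG) (hf n) fun a => min_le_left _ _
    · have hfG : Integrable (fun a => min (f n a) (G a)) μ := (hf n).inf hG
      have hgG' : Integrable (fun a => min (g n a) (G a)) μ := (hg n).inf hG
      rw [← integral_sub (hf n) hfG, ← integral_sub (hg n) hgG']
      refine integral_mono ((hf n).sub hfG) ((hg n).sub hgG') fun a => ?_
      have := hfg n a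
      simp only
      grind
  simpa using h3.add h2

lemma distFun_nonneg (μ : Measure ℝ) (u : ℝ) : 0 ≤ distFun μ u :=
  integral_nonneg fun x => stepFamily_nonneg u x

section DistFun

variable (μ : Measure ℝ) [IsProbabilityMeasure μ]

lemma integrable_stepFamily (u : ℝ) : Integrable (stepFamily u) μ :=
  .of_bound (measurable_stepFamily.comp measurable_prodMk_left).aestronglyMeasurable 1
    (ae_of_all _ fun x => by
      rw [norm_of_nonneg (stepFamily_nonneg u x)]
      exact stepFamily_le_one u x)

lemma distFun_le_one (u : ℝ) : distFun μ u ≤ 1 := by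
  simpa [distFun] using integral_mono (integrable_stepFamily μ u) (integrable_const (1 : ℝ))
    fun x => stepFamily_le_one u x

lemma stepFamily_mono (x : ℝ) : Monotone fun u => stepFamily u x := fun u v huv => by
  simp only [stepFamily, indicator_apply, mem_Iic, Pi.one_apply]
  grind

lemma distFun_mono : Monotone (distFun μ) := fun u v huv =>
  integral_mono (integrable_stepFamily μ u) (integrable_stepFamily μ v)
    fun x => stepFamily_mono x huv

lemma stepFamily_eq_zero_or_one (u x : ℝ) : stepFamily u x = 0 ∨ stepFamily u x = 1 := by
  simp only [stepFamily, indicator_apply, Pi.one_apply]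
  grind

/-- The distance of the distribution function of `μ` to that of the point mass at `0`. -/
noncomputable def tailFun (μ : Measure ℝ) (u : ℝ) : ℝ := |distFun μ u - stepFamily u 0|

lemma tailFun_eq_integral (u : ℝ) :
    tailFun μ u = ∫ x, |stepFamily u x - stepFamily u 0| ∂μ := by
  have h := integral_sub (integrable_stepFamily μ u) (integrable_const (stepFamily u 0))
  simp only [integral_const, probReal_univ, one_smul] at h
  rw [tailFun, distFun, ← h]
  rcases stepFamily_eq_zero_or_one u 0 with h0 | h0 <;> rw [h0]
  · have := fun x => sub_nonneg.2 (stepFamily_nonneg u x)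
    rw [abs_of_nonneg (integral_nonneg this)]
    exact integral_congr_ae (ae_of_all _ fun x => (abs_of_nonneg (this x)).symm)
  · have := fun x => sub_nonpos.2 (stepFamily_le_one u x)
    rw [abs_of_nonpos (integral_nonpos this), ← integral_neg]
    exact integral_congr_ae (ae_of_all _ fun x => (abs_of_nonpos (this x)).symm)

variable {μ}

lemma integrable_prod_abs_stepFamily_sub (hμ : Integrable id μ) :
    Integrable (fun p : ℝ × ℝ => |stepFamily p.1 p.2 - stepFamily p.1 0|) (volume.prod μ) := by
  have hm : Measurable fun p : ℝ × ℝ => |stepFamily p.1 p.2 - stepFamily p.1 0| :=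
    (measurable_stepFamily.sub
      (measurable_stepFamily.comp (measurable_fst.prodMk measurable_const))).norm
  rw [integrable_prod_iff' hm.aestronglyMeasurable]
  refine ⟨ae_of_all _ fun x => integrable_abs_stepFamily_sub x 0, ?_⟩
  simp only [norm_abs_eq_norm, norm_eq_abs, integral_abs_stepFamily_sub, sub_zero]
  exact hμ.abs

lemma integrable_tailFun (hμ : Integrable id μ) : Integrable (tailFun μ) := by
  have := (integrable_prod_abs_stepFamily_sub hμ).integral_prod_left
  simpa only [← tailFun_eq_integral] using this

lemma integral_tailFun (hμ : Integrable id μ) : ∫ u, tailFun μ u = ∫ x, |x| ∂μ := by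
  simp_rw [tailFun_eq_integral]
  rw [integral_integral_swap (integrable_prod_abs_stepFamily_sub hμ)]
  simp only [integral_abs_stepFamily_sub, sub_zero]

lemma sq_distFun_mul_le (μ : Measure ℝ) [IsProbabilityMeasure μ] (p : ℝ × ℝ) :
    (distFun μ (min p.1 p.2) * (1 - distFun μ (max p.1 p.2))) ^ 2
      ≤ tailFun μ p.1 * tailFun μ p.2 := by
  have key : ∀ u, distFun μ u * (1 - distFun μ u) ≤ tailFun μ u := fun u => by
    have h0 := distFun_nonneg μ u
    have h1 := distFun_le_one μ u
    rw [tailFun]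
    rcases stepFamily_eq_zero_or_one u 0 with h | h <;> rw [h]
    · rw [sub_zero, abs_of_nonneg h0]
      nlinarith
    · rw [abs_of_nonpos (by linarith)]
      nlinarith
  have key2 : ∀ u, 0 ≤ distFun μ u * (1 - distFun μ u) := fun u =>
    mul_nonneg (distFun_nonneg μ u) (sub_nonneg.2 (distFun_le_one μ u))
  refine le_trans ?_ (mul_le_mul (key p.1) (key p.2) (key2 _) ((key2 _).trans (key _)))
  rw [(distFun_mono μ).map_min, (distFun_mono μ).map_max, mul_pow, mul_mul_mul_comm]
  have h0 := distFun_nonneg μ p.1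
  have h1 := distFun_le_one μ p.1
  have h2 := distFun_nonneg μ p.2
  have h3 := distFun_le_one μ p.2
  have hmn := le_min h0 h2
  have hmx := max_le h1 h3
  refine mul_le_mul ?_ ?_ (sq_nonneg _) (mul_nonneg h0 h2)
  · rw [sq]
    exact mul_le_mul (min_le_left _ _) (min_le_right _ _) hmn h0
  · rw [sq]
    exact mul_le_mul (sub_le_sub_left (le_max_left _ _) _) (sub_le_sub_left (le_max_right _ _) _)
      (sub_nonneg.2 hmx) (sub_nonneg.2 h1)

end DistFun

/-- Monotone functions which converge at the rationals to a monotone function do so almost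
everywhere. -/
lemma ae_tendsto_of_tendsto_rat {f : ℕ → ℝ → ℝ} {F : ℝ → ℝ} (hf : ∀ n, Monotone (f n))
    (hF : Monotone F) (h : ∀ q : ℚ, Tendsto (fun n => f n q) atTop (𝓝 (F q))) :
    ∀ᵐ u, Tendsto (fun n => f n u) atTop (𝓝 (F u)) := by
  have hc : ∀ᵐ u : ℝ, ContinuousAt F u := by
    simpa [ae_iff] using hF.countable_not_continuousAt.measure_zero volume
  refine hc.mono fun u hu => tendsto_order.2 ⟨fun a ha => ?_, fun a ha => ?_⟩
  · obtain ⟨l, hl, hlu⟩ := exists_Ioc_subset_of_mem_nhds (hu.eventually_const_lt ha)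
      ⟨u - 1, sub_one_lt u⟩
    obtain ⟨q, hq1, hq2⟩ := exists_rat_btwn hl
    filter_upwards [(h q).eventually_const_lt (hlu ⟨hq1, hq2.le⟩)] with n hn
    exact hn.trans_le (hf n hq2.le)
  · obtain ⟨l, hl, hlu⟩ := exists_Ico_subset_of_mem_nhds (hu.eventually_lt_const ha)
      ⟨u + 1, lt_add_one u⟩
    obtain ⟨q, hq1, hq2⟩ := exists_rat_btwn hl
    filter_upwards [(h q).eventually_lt_const (hlu ⟨hq1.le, hq2⟩)] with n hn
    exact (hf n hq1.le).trans_lt hn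

section Empirical

/-- The empirical measure of the first `n + 1` terms of `y`. -/
noncomputable def empMeasure (y : ℕ → ℝ) (n : ℕ) : Measure ℝ :=
  ((n + 1 : ℕ) : ENNReal)⁻¹ • ∑ i ∈ Finset.range (n + 1), Measure.dirac (y i)

instance (y : ℕ → ℝ) (n : ℕ) : IsProbabilityMeasure (empMeasure y n) := ⟨by
  rw [empMeasure, Measure.smul_apply, Measure.finsetSum_apply]
  simp only [measure_univ, Finset.sum_const, Finset.card_range, nsmul_eq_mul, mul_one, smul_eq_mul]
  exact ENNReal.inv_mul_cancel (by simp) (by simp)⟩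

lemma integrable_empMeasure (y : ℕ → ℝ) (n : ℕ) (f : ℝ → ℝ) : Integrable f (empMeasure y n) :=
  (integrable_finsetSum_measure.2 fun i _ => integrable_dirac (by simp)).smul_measure (by simp)

lemma integral_empMeasure (y : ℕ → ℝ) (n : ℕ) (f : ℝ → ℝ) :
    ∫ x, f x ∂(empMeasure y n) = (∑ i ∈ Finset.range (n + 1), f (y i)) / ((n + 1 : ℕ) : ℝ) := by
  rw [empMeasure, integral_smul_measure,
    integral_finsetSum_measure fun i _ => integrable_dirac (by simp)]
  simp only [integral_dirac, smul_eq_mul, ENNReal.toReal_inv, ENNReal.toReal_natCast]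
  rw [div_eq_inv_mul]

lemma countLE_eq_distFun (y : ℕ → ℝ) (n : ℕ) (u : ℝ) :
    (countLE (fun i : Fin (n + 1) => y i) u : ℝ) = (n + 1 : ℕ) * distFun (empMeasure y n) u := by
  rw [distFun, integral_empMeasure, mul_div_cancel₀ _ (by positivity), countLE,
    Finset.sum_range, ← Finset.sum_boole]
  simp [stepFamily, indicator_apply]

end Empirical

end DistanceVariance

namespace DistanceVariance

open MeasureTheory Set Real Filter Topology

section Limits

variable {μ : Measure ℝ} [IsProbabilityMeasure μ] {y : ℕ → ℝ}

lemma tendsto_integral_empMeasure (hμ : Integrable id μ)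
    (hF : ∀ q : ℚ, Tendsto (fun n => distFun (empMeasure y n) q) atTop (𝓝 (distFun μ q)))
    (habs : Tendsto (fun n => ∫ x, |x| ∂(empMeasure y n)) atTop (𝓝 (∫ x, |x| ∂μ)))
    {φ : ℕ → ℝ × ℝ → ℝ} (hm : ∀ n, Measurable (φ n)) (h0 : ∀ n p, 0 ≤ φ n p)
    (hle : ∀ n p, φ n p ≤ (distFun (empMeasure y n) (min p.1 p.2) *
      (1 - distFun (empMeasure y n) (max p.1 p.2))) ^ 2)
    (hlim : ∀ p : ℝ × ℝ,
      Tendsto (fun n => distFun (empMeasure y n) (min p.1 p.2)) atTop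
        (𝓝 (distFun μ (min p.1 p.2))) →
      Tendsto (fun n => distFun (empMeasure y n) (max p.1 p.2)) atTop
        (𝓝 (distFun μ (max p.1 p.2))) →
      Tendsto (fun n => φ n p) atTop
        (𝓝 ((distFun μ (min p.1 p.2) * (1 - distFun μ (max p.1 p.2))) ^ 2))) :
    Tendsto (fun n => ∫ p, φ n p) atTop
      (𝓝 (∫ p : ℝ × ℝ, (distFun μ (min p.1 p.2) * (1 - distFun μ (max p.1 p.2))) ^ 2)) := by
  have hae := ae_tendsto_of_tendsto_rat (fun n => distFun_mono (empMeasure y n)) (distFun_mono μ) hF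
  have hae1 : ∀ᵐ p : ℝ × ℝ, Tendsto (fun n => distFun (empMeasure y n) p.1) atTop
      (𝓝 (distFun μ p.1)) := Measure.quasiMeasurePreserving_fst.ae hae
  have hae2 : ∀ᵐ p : ℝ × ℝ, Tendsto (fun n => distFun (empMeasure y n) p.2) atTop
      (𝓝 (distFun μ p.2)) := Measure.quasiMeasurePreserving_snd.ae hae
  have hi : ∀ n, Integrable (tailFun (empMeasure y n)) := fun n =>
    integrable_tailFun (integrable_empMeasure y n id)
  refine tendsto_integral_of_tendsto_dominating
    (g := fun n p => tailFun (empMeasure y n) p.1 * tailFun (empMeasure y n) p.2)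
    (G := fun p => tailFun μ p.1 * tailFun μ p.2) (fun n => (hm n).aestronglyMeasurable)
    (fun n => (hi n).mul_prod (hi n)) ((integrable_tailFun hμ).mul_prod (integrable_tailFun hμ))
    h0 (fun n p => (hle n p).trans (sq_distFun_mul_le _ p)) ?_ ?_ ?_
  · filter_upwards [hae1, hae2] with p h1 h2
    rcases le_total p.1 p.2 with h | h
    · exact hlim p (by rwa [min_eq_left h]) (by rwa [max_eq_right h])
    · exact hlim p (by rwa [min_eq_right h]) (by rwa [max_eq_left h])
  · filter_upwards [hae1, hae2] with p h1 h2
    exact (h1.sub_const _).abs.mul (h2.sub_const _).abs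
  · simp_rw [Measure.volume_eq_prod, integral_prod_mul, integral_tailFun hμ,
      fun n => integral_tailFun (integrable_empMeasure y n id)]
    exact habs.mul habs

lemma measurable_distFun (μ : Measure ℝ) [IsProbabilityMeasure μ] : Measurable (distFun μ) :=
  (distFun_mono μ).measurable

lemma tendsto_natCast_pow_div_choose (k : ℕ) :
    Tendsto (fun n : ℕ => ((n + 1 : ℕ) : ℝ) ^ k / ((n + 1).choose k : ℝ)) atTop
      (𝓝 (k.factorial : ℝ)) := by
  have h1 : Tendsto (fun n : ℕ => (n : ℝ) * (n : ℝ)⁻¹) atTop (𝓝 1) :=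
    tendsto_const_nhds.congr' <| (eventually_ge_atTop 1).mono fun n hn => 
      (mul_inv_cancel₀ (Nat.cast_ne_zero.2 (by omega))).symm
  have h2 := ((ProbabilityTheory.tendsto_choose_mul_pow_atTop k h1).inv₀
    (by positivity)).comp (tendsto_add_atTop_nat 1)
  simp only [one_pow, one_div, inv_inv] at h2
  refine h2.congr fun n => ?_
  simp only [Function.comp_apply, mul_inv, inv_pow, inv_inv]
  rw [div_eq_inv_mul]

theorem tendsto_spacingDistVar (hμ : Integrable id μ)
    (hF : ∀ q : ℚ, Tendsto (fun n => distFun (empMeasure y n) q) atTop (𝓝 (distFun μ q)))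
    (habs : Tendsto (fun n => ∫ x, |x| ∂(empMeasure y n)) atTop (𝓝 (∫ x, |x| ∂μ))) :
    Tendsto (fun n : ℕ => spacingDistVar fun i : Fin n => y i) atTop
      (𝓝 (4 * ∫ p : ℝ × ℝ, (distFun μ (min p.1 p.2) * (1 - distFun μ (max p.1 p.2))) ^ 2)) := by
  rw [← tendsto_add_atTop_iff_nat 1]
  have h1 := tendsto_integral_empMeasure hμ hF habs
    (φ := fun n p => (distFun (empMeasure y n) (min p.1 p.2) *
      (1 - distFun (empMeasure y n) (max p.1 p.2))) ^ 2)
    (fun n => (((measurable_distFun _).comp (measurable_fst.min measurable_snd)).mul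
      (((measurable_distFun _).comp (measurable_fst.max measurable_snd)).const_sub 1)).pow_const 2)
    (fun n p => sq_nonneg _) (fun n p => le_rfl)
    (fun p h2 h3 => (h2.mul (h3.const_sub 1)).pow 2)
  have h2 := ((tendsto_natCast_pow_div_choose 2).pow 2).mul h1
  norm_num at h2
  refine h2.congr fun n => ?_
  rw [spacingDistVar_eq_integral]
  simp_rw [countLE_eq_distFun y n]
  rw [div_pow, div_eq_inv_mul, mul_assoc, ← integral_const_mul]
  congr 2
  funext p
  push_cast
  ring

theorem tendsto_uStat (hμ : Integrable id μ)
    (hF : ∀ q : ℚ, Tendsto (fun n => distFun (empMeasure y n) q) atTop (𝓝 (distFun μ q)))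
    (habs : Tendsto (fun n => ∫ x, |x| ∂(empMeasure y n)) atTop (𝓝 (∫ x, |x| ∂μ))) :
    Tendsto (fun n : ℕ => uStat fun i : Fin n => y i) atTop
      (𝓝 (4 * ∫ p : ℝ × ℝ, (distFun μ (min p.1 p.2) * (1 - distFun μ (max p.1 p.2))) ^ 2)) := by
  rw [← tendsto_add_atTop_iff_nat 1]
  set E : ℕ → ℝ → ℝ := fun n => distFun (empMeasure y n)
  set N : ∀ n : ℕ, ℝ → ℕ := fun n => countLE fun i : Fin (n + 1) => y i
  set φ : ℕ → ℝ × ℝ → ℝ := fun n p => 4 / ((n + 1 : ℕ) : ℝ) ^ 4 *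
    (((N n (min p.1 p.2)).choose 2 : ℝ) * ((n + 1 - N n (max p.1 p.2)).choose 2 : ℝ))
  have hN : ∀ n u, (N n u : ℝ) = (n + 1 : ℕ) * E n u := fun n u => countLE_eq_distFun y n u
  have hφ : ∀ n p, φ n p = (E n (min p.1 p.2) * (E n (min p.1 p.2) - ((n : ℝ) + 1)⁻¹)) *
      ((1 - E n (max p.1 p.2)) * (1 - E n (max p.1 p.2) - ((n : ℝ) + 1)⁻¹)) := fun n p => by
    simp only [φ]
    rw [Nat.cast_choose_two, Nat.cast_choose_two, Nat.cast_sub (countLE_le _ _), hN, hN]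
    have : (n : ℝ) + 1 ≠ 0 := by positivity
    push_cast
    field_simp
    ring
  have hEm : ∀ n, Measurable (E n) := fun n => measurable_distFun _
  have h1 := tendsto_integral_empMeasure hμ hF habs (φ := φ) (fun n => ?_) (fun n p => by positivity)
    (fun n p => ?_) (fun p h2 h3 => ?_)
  · have h2 := ((tendsto_natCast_pow_div_choose 4).mul h1).const_mul (1 / 6)
    have h24 : (1 / 6 : ℝ) * ((Nat.factorial 4 : ℕ) * ∫ p : ℝ × ℝ,
        (distFun μ (min p.1 p.2) * (1 - distFun μ (max p.1 p.2))) ^ 2)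
        = 4 * ∫ p : ℝ × ℝ, (distFun μ (min p.1 p.2) * (1 - distFun μ (max p.1 p.2))) ^ 2 := by
      norm_num [Nat.factorial]
      ring
    rw [h24] at h2
    refine h2.congr fun n => ?_
    rw [uStat_eq_integral, integral_const_mul]
    have : ((n + 1 : ℕ) : ℝ) ≠ 0 := by positivity
    field_simp
    norm_num
    simp only [N]
    ring
  · simp only [funext (hφ n)]
    have hmin := (hEm n).comp (measurable_fst.min (measurable_snd (α := ℝ) (β := ℝ)))
    have hmax := (hEm n).comp (measurable_fst.max (measurable_snd (α := ℝ) (β := ℝ)))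
    exact (hmin.mul (hmin.sub_const _)).mul
      ((hmax.const_sub 1).mul ((hmax.const_sub 1).sub_const _))
  · have key : ∀ m : ℕ, (m.choose 2 : ℝ) ≤ (m : ℝ) ^ 2 / 2 := fun m => by
      rw [Nat.cast_choose_two]
      have : (0 : ℝ) ≤ m := by positivity
      nlinarith
    calc φ n p ≤ 4 / ((n + 1 : ℕ) : ℝ) ^ 4 * (((N n (min p.1 p.2) : ℝ) ^ 2 / 2) *
          (((n + 1 - N n (max p.1 p.2) : ℕ) : ℝ) ^ 2 / 2)) := by
          refine mul_le_mul_of_nonneg_left (mul_le_mul (key _) (key _) ?_ ?_) ?_ <;> positivity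
      _ = _ := by
          rw [Nat.cast_sub (countLE_le _ _), hN, hN]
          have : (n : ℝ) + 1 ≠ 0 := by positivity
          push_cast
          field_simp
          norm_num
          rfl
  · simp only [hφ]
    have hinv := tendsto_one_div_add_atTop_nhds_zero_nat (𝕜 := ℝ)
    simp only [one_div] at hinv
    have := (h2.mul (h2.sub hinv)).mul ((h3.const_sub 1).mul ((h3.const_sub 1).sub hinv))
    convert this using 2
    ring

end Limits

section StrongLaw

open ProbabilityTheory

variable {Ω Ω' : Type*} [MeasurableSpace Ω] [MeasurableSpace Ω'] {P : Measure Ω}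
  {P' : Measure Ω'} {X : Ω' → ℝ} {Xs : ℕ → Ω → ℝ}

lemma ae_tendsto_integral_empMeasure (hindep : iIndepFun Xs P)
    (hident : ∀ i, IdentDistrib (Xs i) X P P') {f : ℝ → ℝ} (hf : Measurable f)
    (hint : Integrable f (P'.map X)) :
    ∀ᵐ ω ∂P, Tendsto (fun n => ∫ x, f x ∂(empMeasure (fun i => Xs i ω) n)) atTop
      (𝓝 (∫ x, f x ∂(P'.map X))) := by
  have hX : AEMeasurable X P' := (hident 0).aemeasurable_snd
  have hid : ∀ i, IdentDistrib (f ∘ Xs i) (f ∘ X) P P' := fun i => (hident i).comp hf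
  have hint0 : Integrable (f ∘ Xs 0) P :=
    (hid 0).integrable_iff.2 ((integrable_map_measure hf.aestronglyMeasurable hX).1 hint)
  have h := strong_law_ae_real (fun i => f ∘ Xs i) hint0
    (fun i j hij => (hindep.indepFun hij).comp hf hf) (fun i => (hid i).trans (hid 0).symm)
  rw [(hid 0).integral_eq] at h
  rw [integral_map hX hf.aestronglyMeasurable]
  filter_upwards [h] with ω hω
  simp_rw [integral_empMeasure]
  exact hω.comp (tendsto_add_atTop_nat 1)

end StrongLaw

end DistanceVariance

theorem mainTheorem9 {Ω Ω' : Type*} [MeasurableSpace Ω] [MeasurableSpace Ω']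
    (P : MeasureTheory.Measure Ω) [MeasureTheory.IsProbabilityMeasure P]
    (P' : MeasureTheory.Measure Ω') [MeasureTheory.IsProbabilityMeasure P']
    (X : Ω' → ℝ) (hX : MeasureTheory.Integrable X P')
    (Xs : ℕ → Ω → ℝ) (hindep : ProbabilityTheory.iIndepFun Xs P)
    (hident : ∀ i, ProbabilityTheory.IdentDistrib (Xs i) X P P') :
    MeasureTheory.Integrable (DistanceVariance.integrand (P'.map X)) ∧
    (∀ᵐ ω ∂P, Filter.Tendsto
      (fun n : ℕ => DistanceVariance.spacingDistVar (fun i : Fin n => Xs i ω))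
      Filter.atTop (nhds (DistanceVariance.distVar P' X))) ∧
    (∀ᵐ ω ∂P, Filter.Tendsto
      (fun n : ℕ => DistanceVariance.spacingDistVar (fun i : Fin n => Xs i ω)
        - DistanceVariance.uStat (fun i : Fin n => Xs i ω))
      Filter.atTop (nhds 0)) := by
  have hXm : AEMeasurable X P' := hX.aemeasurable
  have : MeasureTheory.IsProbabilityMeasure (P'.map X) :=
    MeasureTheory.Measure.isProbabilityMeasure_map hXm
  have hμ : MeasureTheory.Integrable id (P'.map X) :=
    (MeasureTheory.integrable_map_measure measurable_id.aestronglyMeasurable hXm).2 hX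
  have hF : ∀ᵐ ω ∂P, ∀ q : ℚ, Filter.Tendsto
      (fun n => DistanceVariance.distFun (DistanceVariance.empMeasure (fun i => Xs i ω) n) q)
      Filter.atTop (nhds (DistanceVariance.distFun (P'.map X) q)) :=
    MeasureTheory.ae_all_iff.2 fun q : ℚ =>
    DistanceVariance.ae_tendsto_integral_empMeasure hindep hident
      (f := DistanceVariance.stepFamily q)
      (DistanceVariance.measurable_stepFamily.comp measurable_prodMk_left)
      (DistanceVariance.integrable_stepFamily _ q)
  have habs := DistanceVariance.ae_tendsto_integral_empMeasure hindep hident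
    (f := fun x => |x|) measurable_norm hμ.abs
  have hU : ∀ᵐ ω ∂P, Filter.Tendsto
      (fun n : ℕ => DistanceVariance.spacingDistVar (fun i : Fin n => Xs i ω))
      Filter.atTop (nhds (DistanceVariance.distVar P' X)) := by
    filter_upwards [hF, habs] with ω h1 h2
    rw [DistanceVariance.distVar, DistanceVariance.integral_integrand hμ]
    exact DistanceVariance.tendsto_spacingDistVar (y := fun i => Xs i ω) hμ h1 h2
  refine ⟨DistanceVariance.integrable_integrand hμ, hU, ?_⟩
  filter_upwards [hF, habs, hU] with ω h1 h2 h3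
  rw [DistanceVariance.distVar, DistanceVariance.integral_integrand hμ] at h3
  simpa using h3.sub (DistanceVariance.tendsto_uStat (y := fun i => Xs i ω) hμ h1 h2)
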